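/- A finite sequence $(v_k)_{k\in I}$ in a finite-dimensional complex Hilbert space $\mathcal H$ is a \emph{full spark frame} if it is a frame (there are $0<A\le B$ with $A\|w\|^2\le\sum_{k\in I}|\langle w,v_k\rangle|^2\le B\|w\|^2$ for all $w\in\mathcal H$) and the vectors $v_k$, $k\in S$, are linearly independent for every $S\subseteq I$ with $|S|=\dim\mathcal H$. Let $\pi$ be an irreducible unitary representation of a finite group $G$ on such a space $\mathcal H$. We call $\pi$ \emph{full spark} if $(\pi(g)v)_{g\in G}$ is a full spark frame for some $v\in\mathcal H$, and \emph{spark deficient} if this holds for no $v\in\mathcal H$. The group $G$ is \emph{irreducibly spark deficient} if every irreducible unitary representation of $G$ that is not a character (i.e. is not one-dimensional) is spark deficient. Let $N\ge 1$, let $H$ be a subgroup of $\operatorname{Aut}(\mathbb Z_N)\cong\mathbb Z_N^\times$, and let $\mathbb Z_N\rtimes H$ be the semidirect product formed with the natural action of $H$ on $\mathbb Z_N$. (1) If $N$ is composite and $|H|\ge p$, where $p$ is the smallest prime divisor of $N$, then $\mathbb Z_N\rtimes H$ is irreducibly spark deficient. (2) If $N=p^n$ with $p$ prime and $n\ge 0$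 an integer, $|H|<p$, and no two distinct elements of $H$, viewed as residues in $\{0,\dots,N-1\}$ (an automorphism $h$ corresponding to the residue $h(1)$), are congruent modulo $p$, then $\mathbb Z_N\rtimes H$ has an irreducible unitary representation of dimension $|H|$ that is full spark. -/

import Mathlib

universe u w

/-- A finite sequence `v` of vectors is a frame if there are bounds `0 < A ≤ B` with
`A ‖w‖² ≤ ∑ₖ |⟨w, vₖ⟩|² ≤ B ‖w‖²` for all `w`. -/
def IsFrame {V : Type*} [NormedAddCommGroup V] [InnerProductSpace ℂ V] {I : Type*} [Finite I]
    (v : I → V) : Prop :=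
  ∃ A B : ℝ, 0 < A ∧ A ≤ B ∧ ∀ w : V,
    A * ‖w‖ ^ 2 ≤ ∑ᶠ k, ‖inner ℂ w (v k)‖ ^ 2 ∧ ∑ᶠ k, ‖inner ℂ w (v k)‖ ^ 2 ≤ B * ‖w‖ ^ 2

/-- A finite sequence is a full spark frame if it is a frame and any `dim V` of its terms
(taken at distinct indices) are linearly independent, i.e. form a basis of `V`. -/
def IsFullSparkFrame {V : Type*} [NormedAddCommGroup V] [InnerProductSpace ℂ V]
    {I : Type*} [Finite I] (v : I → V) : Prop :=
  IsFrame v ∧ ∀ s : Finset I, s.card = Module.finrank ℂ V →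
    LinearIndependent ℂ (fun i : s => v i)

/-- A unitary representation of `G` on `V`: a homomorphism into the group of unitary
operators of `V`. -/
abbrev UnitaryRep (G : Type*) [Group G] (V : Type*) [NormedAddCommGroup V]
    [InnerProductSpace ℂ V] : Type _ :=
  G →* (V ≃ₗᵢ[ℂ] V)

namespace UnitaryRep

variable {G : Type*} [Group G] {V : Type*} [NormedAddCommGroup V] [InnerProductSpace ℂ V]

/-- The linear representation underlying a unitary representation. -/
def toRepresentation (π : UnitaryRep G V) : Representation ℂ G V where
  toFun g := (π g).toLinearEquiv.toLinearMap
  map_one' := by ext; simp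
  map_mul' g h := by ext; simp

/-- `π` is irreducible: `V ≠ 0` and the only invariant subspaces are `0` and `V`. -/
def IsIrreducible (π : UnitaryRep G V) : Prop :=
  π.toRepresentation.IsIrreducible

/-- `π` is full spark: the orbit `(π(g) v)_{g ∈ G}` of some vector is a full spark frame. -/
def IsFullSpark [Finite G] (π : UnitaryRep G V) : Prop :=
  ∃ v : V, IsFullSparkFrame (fun g : G => π g v)

/-- `π` is spark deficient: no orbit `(π(g) v)_{g ∈ G}` is a full spark frame. -/
def IsSparkDeficient [Finite G] (π : UnitaryRep G V) : Prop :=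
  ∀ v : V, ¬ IsFullSparkFrame (fun g : G => π g v)

end UnitaryRep

/-- A finite group is irreducibly spark deficient if each of its irreducible unitary
representations which is not a character (i.e. is not one-dimensional) is spark deficient. -/
def IrreduciblySparkDeficient (G : Type u) [Group G] [Finite G] : Prop :=
  ∀ (V : Type w) [NormedAddCommGroup V] [InnerProductSpace ℂ V] [FiniteDimensional ℂ V]
    (π : UnitaryRep G V), π.IsIrreducible → Module.finrank ℂ V ≠ 1 → π.IsSparkDeficient

/-- The automorphism group of the (multiplicatively written) cyclic group `ℤ_N`. -/
abbrev AutZMod (N : ℕ) : Type := MulAut (Multiplicative (ZMod N))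

/-- The residue `a ∈ {0, …, N - 1}` for which the automorphism `h` of `ℤ_N` is `x ↦ a x`. -/
def AutZMod.residue {N : ℕ} (h : AutZMod N) : ℕ :=
  (Multiplicative.toAdd (h (Multiplicative.ofAdd 1))).val

/-- The semidirect product `ℤ_N ⋊ H` of `ℤ_N` with a group `H` of automorphisms of it. -/
abbrev CyclicSemidirect (N : ℕ) (H : Subgroup (AutZMod N)) : Type :=
  SemidirectProduct (Multiplicative (ZMod N)) H H.subtype

instance CyclicSemidirect.instFinite (N : ℕ) [NeZero N] (H : Subgroup (AutZMod N)) :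
    Finite (CyclicSemidirect N H) :=
  Finite.of_equiv _ SemidirectProduct.equivProd.symm

/-! Deficiency: suppose an irreducible representation of dimension at least 2 has a full spark orbit
of `v`. The fixed space of a translation is invariant, so a nontrivial translation fixes no nonzero
vector; otherwise it would act trivially and `v` would recur in its orbit. Hence `H` moves an
eigenvector of the generating translation to `|H|` distinct eigenvalues, and the dimension is at
least `|H| ≥ p`. Yet if `b` is a translation of order `p`, then `v + bv + ⋯ + b^(p-1)v` is fixed by
`b`, hence zero: `p` orbit vectors are dependent.

Full spark: induce the standard character to functions on `H` and try `v(h) = t ^ w h`. Any `|H|`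
orbit vectors give a determinant polynomial in `t`. For fast growing `w`, the permutations of top
degree all induce one assignment `κ`, so the top coefficient is, up to reordering, block diagonal
with minors of the Fourier matrix as blocks (`det_orbit_ne_zero`). These are nonzero by Chebotarev's
argument: modulo a place over `p` the roots of unity become 1, and a sum of `m` monomials with
exponents distinct mod `p` is not divisible by `(X - 1) ^ m`. A generic `t` then serves all subsets
at once. -/

/-! ### Chebotarev's theorem at `p`-power roots of unity -/

open Polynomial in
/-- A polynomial with at most `m` terms whose exponents are distinct in the field `k` vanishes
if it is divisible by `(X - 1) ^ m`. -/
theorem Polynomial.coeff_eq_zero_of_X_sub_one_pow_dvd {k ι : Type*} [Field k] [DecidableEq ι]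
    (r : ι → ℕ) (s : Finset ι) : ∀ (m : ℕ) (c : ι → k), s.card ≤ m →
    (∀ i ∈ s, ∀ j ∈ s, (r i : k) = r j → i = j) →
    (X - 1 : k[X]) ^ m ∣ ∑ i ∈ s, C (c i) * X ^ r i → ∀ i ∈ s, c i = 0 := by
  induction s using Finset.induction_on with
  | empty => simp
  | insert a s ha ih =>
    intro m c hm hr hdvd
    rw [Finset.card_insert_of_notMem ha] at hm
    obtain ⟨m, rfl⟩ : ∃ l, m = l + 1 := ⟨m - 1, by omega⟩
    set f : k[X] := ∑ i ∈ insert a s, C (c i) * X ^ r i with hf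
    -- The operator `X d/dX - r a` is diagonal on monomials, kills the term of `a`, and costs only
    -- one factor `X - 1`.
    have hmono : ∀ i, X * derivative (C (c i) * X ^ r i : k[X]) - C (r a : k) * (C (c i) * X ^ r i)
        = C (c i * (r i - r a)) * X ^ r i := by
      intro i
      rcases Nat.eq_zero_or_pos (r i) with h0 | h0
      · simp [h0]; ring
      · obtain ⟨l, hl⟩ : ∃ l, r i = l + 1 := ⟨r i - 1, by omega⟩
        rw [hl]
        simp only [derivative_mul, derivative_C, derivative_X_pow, map_mul, map_sub, map_natCast]
        simp
        ring
    have hg : X * derivative f - C (r a : k) * f =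
        ∑ i ∈ s, C (c i * (r i - r a)) * X ^ r i := by
      rw [hf, derivative_sum, Finset.mul_sum, Finset.mul_sum, ← Finset.sum_sub_distrib,
        Finset.sum_congr rfl fun i _ => hmono i, Finset.sum_insert ha]
      simp
    have hs : ∀ i ∈ s, c i = 0 := by
      have hd : (X - 1 : k[X]) ^ m ∣ X * derivative f - C (r a : k) * f := by
        refine dvd_sub (Dvd.dvd.mul_left ?_ _)
          (((pow_dvd_pow _ (Nat.le_succ m)).trans hdvd).mul_left _)
        obtain ⟨q, hq⟩ := hdvd
        rw [hq, derivative_mul, derivative_pow_succ]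
        refine dvd_add ?_ ((pow_dvd_pow _ (Nat.le_succ m)).mul_right _)
        exact Dvd.dvd.mul_right (Dvd.dvd.mul_right (Dvd.intro_left _ rfl) _) _
      rw [hg] at hd
      intro i hi
      have := ih m _ (by omega) (fun i hi j hj => hr i (Finset.mem_insert_of_mem hi) j
        (Finset.mem_insert_of_mem hj)) hd i hi
      rcases mul_eq_zero.1 this with h | h
      · exact h
      · exact absurd (hr i (Finset.mem_insert_of_mem hi) a (Finset.mem_insert_self _ _)
          (sub_eq_zero.1 h)) (by rintro rfl; exact ha hi)
    intro i hi
    rcases Finset.mem_insert.1 hi with rfl | hi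
    · have hfi : f = C (c i) * X ^ r i := by
        rw [hf, Finset.sum_insert ha, Finset.sum_eq_zero, add_zero]
        intro j hj
        simp [hs j hj]
      have h1 : (X - 1 : k[X]) ∣ f := (Dvd.intro_left _ (pow_succ _ _).symm).trans hdvd
      obtain ⟨q, hq⟩ := h1
      have := congrArg (eval 1) (hfi.symm.trans hq)
      simpa using this
    · exact hs i hi

/-- A valuation subring of `ℂ` whose residue field has characteristic `p`. -/
theorem exists_valuationSubring_residue_charP (p : ℕ) (hp : p.Prime) :
    ∃ B : ValuationSubring ℂ, CharP (IsLocalRing.ResidueField B) p := by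
  let A : Subring ℂ := (Int.castRingHom ℂ).range
  have hI : Ideal.span {(p : A)} ≠ ⊤ := by
    rw [Ne, Ideal.span_singleton_eq_top]
    intro h
    obtain ⟨⟨y, n, rfl⟩, hy⟩ := h.exists_right_inv
    have h1 : ((p : ℤ) * n : ℂ) = 1 := by
      simpa using congrArg (Subtype.val : A → ℂ) hy
    have h2 : (p : ℤ) * n = 1 := by exact_mod_cast h1
    have h3 : (p : ℤ) ∣ 1 := ⟨n, h2.symm⟩
    exact hp.one_lt.ne' (by exact_mod_cast Int.eq_one_of_dvd_one (by positivity) h3)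
  -- The proper ideal `(p)` of the image of `ℤ` lies in the maximal ideal of some valuation ring of
  -- `ℂ`.
  obtain ⟨B, -, hB⟩ := Ideal.image_subset_nonunits_valuationSubring _ hI
  refine ⟨B, ?_⟩
  have hpB : (p : ℂ) ∈ B.nonunits := hB ⟨p, Ideal.mem_span_singleton_self _, by simp⟩
  rw [CharP.charP_iff_prime_eq_zero hp, ← map_natCast (IsLocalRing.residue B),
    IsLocalRing.residue_eq_zero_iff, ← ValuationSubring.coe_mem_nonunits_iff]
  simpa using hpB

open Polynomial in
/-- Chebotarev's theorem on minors of the Fourier matrix, for prime powers: a sum of powers with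
exponents that are distinct modulo `p` cannot vanish at as many `p`-power roots of unity as it
has terms. -/
theorem coeff_eq_zero_of_vanishing_at_rootsOfUnity {κ : Type*} [DecidableEq κ] {p n : ℕ}
    (hp : p.Prime) (s : Finset κ) (J : Finset ℂ) (hcard : s.card ≤ J.card)
    (hJ : ∀ x ∈ J, x ^ p ^ n = 1) (r : κ → ℕ)
    (hr : ∀ i ∈ s, ∀ j ∈ s, r i ≡ r j [MOD p] → i = j) (c : κ → ℂ)
    (h : ∀ x ∈ J, ∑ i ∈ s, c i * x ^ r i = 0) : ∀ i ∈ s, c i = 0 := by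
  classical
  by_contra! hne
  obtain ⟨B, hB⟩ := exists_valuationSubring_residue_charP p hp
  obtain ⟨i₁, hi₁, hci₁⟩ := hne
  -- Dividing by a coefficient of largest valuation makes all coefficients integral and one of them
  -- 1, so the reduction is not zero.
  obtain ⟨i₀, hi₀, hmax⟩ := s.exists_max_image (fun i => B.valuation (c i)) ⟨i₁, hi₁⟩
  have hci₀ : c i₀ ≠ 0 := by
    intro h0
    have := hmax i₁ hi₁
    simp only [h0, map_zero, le_zero_iff, map_eq_zero] at this
    exact hci₁ this
  have hb : ∀ i, ∃ b : B, i ∈ s → (b : ℂ) * c i₀ = c i := by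
    intro i
    by_cases hi : i ∈ s
    · obtain ⟨b, hb⟩ := (B.valuation_le_iff _ _).1 (hmax i hi)
      exact ⟨b, fun _ => hb⟩
    · exact ⟨0, fun h => absurd h hi⟩
  choose b hb using hb
  have hpn : p ^ n ≠ 0 := pow_ne_zero _ hp.ne_zero
  have hmem : ∀ x ∈ J, x ∈ B := by
    intro x hx
    rw [← B.valuation_le_one_iff, ← pow_le_one_iff hpn, ← map_pow, hJ x hx, map_one]
  let J' : Finset B := J.subtype (· ∈ B)
  have hJ'card : J'.card = J.card := by
    rw [Finset.card_subtype, Finset.filter_true_of_mem hmem]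
  set f : B[X] := ∑ i ∈ s, C (b i) * X ^ r i with hf
  have hdvd : (J'.val.map fun y => X - C y).prod ∣ f := by
    by_cases hf0 : f = 0
    · rw [hf0]; exact dvd_zero _
    rw [Multiset.prod_X_sub_C_dvd_iff_le_roots hf0, Multiset.le_iff_subset J'.nodup]
    intro y hy
    have hy : (y : ℂ) ∈ J := Finset.mem_subtype.1 hy
    rw [mem_roots hf0, IsRoot.def, hf, eval_finsetSum]
    apply Subtype.val_injective
    have h1 : (∑ i ∈ s, (b i : ℂ) * (y : ℂ) ^ r i) * c i₀ = 0 := by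
      rw [Finset.sum_mul, ← h _ hy]
      refine Finset.sum_congr rfl fun i hi => ?_
      rw [← hb i hi]; ring
    simpa using (mul_eq_zero.1 h1).resolve_right hci₀
  -- In characteristic `p`, `y ^ p ^ n - 1 = (y - 1) ^ p ^ n`.
  have hres : ∀ y ∈ J', IsLocalRing.residue B y = 1 := by
    intro y hy
    have hy : (y : ℂ) ∈ J := Finset.mem_subtype.1 hy
    have h1 : y ^ p ^ n = 1 := Subtype.val_injective (by simpa using hJ _ hy)
    have h2 : (IsLocalRing.residue B y - 1) ^ p ^ n = 0 := by
      have := Fact.mk hp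
      rw [sub_pow_char_pow, ← map_pow, h1]
      simp
    exact sub_eq_zero.1 (pow_eq_zero_iff hpn |>.1 h2)
  have hdvd' : (X - 1 : (IsLocalRing.ResidueField B)[X]) ^ J'.card ∣
      ∑ i ∈ s, C (IsLocalRing.residue B (b i)) * X ^ r i := by
    have := map_dvd (mapRingHom (IsLocalRing.residue B)) hdvd
    rw [← Finset.prod_eq_multiset_prod, map_prod, Finset.prod_congr rfl (g := fun _ => X - 1),
      Finset.prod_const, hf, map_sum] at this
    · simpa using this
    · intro y hy
      simp [hres y hy]
  have := Polynomial.coeff_eq_zero_of_X_sub_one_pow_dvd r s J'.card _ (hJ'card ▸ hcard)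
    (fun i hi j hj hij => hr i hi j hj ((CharP.natCast_eq_natCast _ p).1 hij)) hdvd' i₀ hi₀
  have h1 : b i₀ = 1 := Subtype.val_injective (mul_right_cancel₀ hci₀ (by simpa using hb i₀ hi₀))
  simp [h1] at this

/-! ### Fast growing weights and the orbit determinant -/

/-- If `κ` takes at `h` the heaviest value among those where `κ` and `κ'` differ, then a
transposition increases the total weight of `κ'`. -/
theorem exists_swap_weight_lt {H : Type*} [Group H] [Fintype H] [DecidableEq H] {w : H → ℕ}
    (hinj : Function.Injective w) (hw : ∀ a b g, w a < w g → w b < w g → w a + w b < w g)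
    {κ κ' : H → H} (hfib : ∀ k, (Finset.univ.filter fun h => κ h = k).card =
      (Finset.univ.filter fun h => κ' h = k).card) {h : H} (hne : κ h ≠ κ' h)
    (hmax : ∀ h₂, κ h₂ ≠ κ' h₂ → w (h₂ * κ' h₂) ≤ w (h * κ h)) :
    ∃ τ : Equiv.Perm H, ∑ i, w (i * κ' i) < ∑ i, w (i * κ' (τ i)) := by
  -- The fibres of `κ` and `κ'` over `κ h` have equal size, and `h` lies only in the first, so the
  -- second has a point outside the first.
  obtain ⟨h₁, hh₁, hh₁'⟩ : ∃ h₁, κ' h₁ = κ h ∧ κ h₁ ≠ κ h := by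
    by_contra! hcon
    have hsub : (Finset.univ.filter fun i => κ' i = κ h) ⊆
        (Finset.univ.filter fun i => κ i = κ h) := by
      intro i hi
      simp only [Finset.mem_filter, Finset.mem_univ, true_and] at hi ⊢
      exact hcon i hi
    have heq := Finset.eq_of_subset_of_card_le hsub (hfib _).le
    have : h ∈ Finset.univ.filter fun i => κ' i = κ h := by rw [heq]; simp
    exact hne (by simpa using this : κ' h = κ h).symm
  have hhne : h₁ ≠ h := by rintro rfl; exact hh₁' rfl
  have h1 : w (h₁ * κ h) < w (h * κ h) := by
    refine lt_of_le_of_ne (hh₁ ▸ hmax h₁ (by rwa [hh₁])) fun e => hhne ?_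
    exact mul_right_cancel (hinj e)
  have h2 : w (h * κ' h) < w (h * κ h) := by
    refine lt_of_le_of_ne (hmax h hne) fun e => hne ?_
    exact (mul_left_cancel (hinj e)).symm
  -- The swap gains `w (h * κ h)`, which alone exceeds the sum of the two weights lost.
  refine ⟨Equiv.swap h h₁, ?_⟩
  have hmem : h₁ ∈ Finset.univ.erase h := by simp [hhne]
  rw [← Finset.add_sum_erase _ _ (Finset.mem_univ h),
    ← Finset.add_sum_erase _ (fun i => w (i * κ' i)) hmem,
    ← Finset.add_sum_erase _ (fun i => w (i * κ' (Equiv.swap h h₁ i))) (Finset.mem_univ h),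
    ← Finset.add_sum_erase _ (fun i => w (i * κ' (Equiv.swap h h₁ i))) hmem,
    Finset.sum_congr rfl (g := fun i => w (i * κ' i)) (s₁ := (Finset.univ.erase h).erase h₁)
      (f := fun i => w (i * κ' (Equiv.swap h h₁ i)))]
  · simp only [Equiv.swap_apply_left, Equiv.swap_apply_right, hh₁]
    have := hw _ _ _ h1 h2
    omega
  · intro i hi
    simp only [Finset.mem_erase, Finset.mem_univ, and_true] at hi
    rw [Equiv.swap_apply_of_ne_of_ne hi.2 hi.1]

/-- Two assignments with the same fibre sizes, each of maximal weight among its rearrangements,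
are equal. -/
theorem eq_of_weight_maximal {H : Type*} [Group H] [Fintype H] [DecidableEq H] {w : H → ℕ}
    (hinj : Function.Injective w) (hw : ∀ a b g, w a < w g → w b < w g → w a + w b < w g)
    {κ κ' : H → H} (hfib : ∀ k, (Finset.univ.filter fun h => κ h = k).card =
      (Finset.univ.filter fun h => κ' h = k).card)
    (hκ : ∀ τ : Equiv.Perm H, ∑ i, w (i * κ (τ i)) ≤ ∑ i, w (i * κ i))
    (hκ' : ∀ τ : Equiv.Perm H, ∑ i, w (i * κ' (τ i)) ≤ ∑ i, w (i * κ' i)) : κ = κ' := by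
  by_contra hne
  obtain ⟨h₀, hh₀⟩ := Function.ne_iff.1 hne
  -- At the heaviest discrepancy, whichever assignment is lighter there can be improved by a swap,
  -- against its maximality.
  obtain ⟨h, hh, hmax⟩ := (Finset.univ.filter fun h => κ h ≠ κ' h).exists_max_image
    (fun h => max (w (h * κ h)) (w (h * κ' h))) ⟨h₀, by simpa using hh₀⟩
  simp only [Finset.mem_filter, Finset.mem_univ, true_and] at hh hmax
  rcases le_total (w (h * κ' h)) (w (h * κ h)) with hle | hle
  · obtain ⟨τ, hτ⟩ := exists_swap_weight_lt hinj hw hfib hh fun h₂ hh₂ =>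
      (le_max_right _ _).trans ((hmax h₂ hh₂).trans (max_le le_rfl hle))
    exact (hκ' τ).not_gt hτ
  · obtain ⟨τ, hτ⟩ := exists_swap_weight_lt hinj hw (fun k => (hfib k).symm) hh.symm fun h₂ hh₂ =>
      (le_max_left _ _).trans ((hmax h₂ hh₂.symm).trans (max_le hle le_rfl))
    exact (hκ τ).not_gt hτ

open Polynomial in
/-- The determinant of `d` vectors of the orbit of `h ↦ X ^ w h` under the induced representation
is a nonzero polynomial when the weights `w` grow fast enough. -/
theorem det_orbit_ne_zero {H : Type*} [Group H] [Fintype H] [DecidableEq H] {w : H → ℕ}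
    (hinj : Function.Injective w) (hw : ∀ a b g, w a < w g → w b < w g → w a + w b < w g)
    {p n : ℕ} (hp : p.Prime) (r : H → ℕ) (hr : ∀ i j, r i ≡ r j [MOD p] → i = j)
    (x : H → ℂ) (hx : ∀ i, x i ^ p ^ n = 1) (k : H → H)
    (hxk : ∀ i j, x i = x j → k i = k j → i = j) :
    (Matrix.of fun h i => C (x i ^ r h) * (X : ℂ[X]) ^ w (h * k i)).det ≠ 0 := by
  let W : Equiv.Perm H → ℕ := fun σ => ∑ i, w (σ i * k i)
  have hW : ∀ σ, W σ = ∑ h, w (h * k (σ.symm h)) := fun σ => by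
    rw [← Equiv.sum_comp σ]; simp [W]
  obtain ⟨σ₀, -, hσ₀⟩ := (Finset.univ : Finset (Equiv.Perm H)).exists_max_image W
    Finset.univ_nonempty
  let κ : H → H := fun h => k (σ₀.symm h)
  have hfib : ∀ (σ : Equiv.Perm H) (l : H), (Finset.univ.filter fun h => k (σ.symm h) = l).card =
      (Finset.univ.filter fun i => k i = l).card := by
    intro σ l
    refine Finset.card_equiv σ.symm fun i => ?_
    simp
  have hmaxiff : ∀ σ : Equiv.Perm H, W σ = W σ₀ ↔ ∀ i, k i = κ (σ i) := by
    intro σ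
    constructor
    · intro h
      have hrearr : ∀ σ' : Equiv.Perm H, W σ' = W σ₀ → ∀ τ : Equiv.Perm H,
          ∑ i, w (i * k (σ'.symm (τ i))) ≤ ∑ i, w (i * k (σ'.symm i)) := by
        intro σ' h' τ
        have := hσ₀ (τ.symm * σ') (Finset.mem_univ _)
        rw [← h', hW, hW] at this
        exact this
      have heq : (fun h => k (σ.symm h)) = κ := eq_of_weight_maximal hinj hw
        (fun l => (hfib σ l).trans (hfib σ₀ l).symm) (hrearr σ h) (hrearr σ₀ rfl)
      intro i
      have := congrFun heq (σ i)
      simpa using this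
    · intro h
      rw [hW σ₀, ← Equiv.sum_comp σ]
      exact Finset.sum_congr rfl fun i _ => by rw [h i]
  let B : Matrix H H ℂ := Matrix.of fun h i => if k i = κ h then x i ^ r h else 0
  -- By `hmaxiff`, the permutations contributing in degree `W σ₀` are exactly those that avoid the
  -- entries replaced by 0 in `B`.
  have hcoeff : (Matrix.of fun h i => C (x i ^ r h) * (X : ℂ[X]) ^ w (h * k i)).det.coeff (W σ₀) =
      B.det := by
    rw [Matrix.det_apply, Matrix.det_apply, finsetSum_coeff]
    refine Finset.sum_congr rfl fun σ _ => ?_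
    simp only [Matrix.of_apply, B, Finset.prod_mul_distrib, Finset.prod_pow_eq_pow_sum,
      ← map_prod]
    rw [Units.smul_def, Units.smul_def, coeff_smul, coeff_C_mul_X_pow]
    congr 1
    by_cases h : ∀ i, k i = κ (σ i)
    · rw [if_pos ((hmaxiff σ).2 h).symm]
      exact Finset.prod_congr rfl fun i _ => by rw [if_pos (h i)]
    · rw [if_neg fun e => h ((hmaxiff σ).1 e.symm)]
      push Not at h
      obtain ⟨i, hi⟩ := h
      exact (Finset.prod_eq_zero (Finset.mem_univ i) (if_neg hi)).symm
  suffices hB : B.det ≠ 0 by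
    intro h0
    rw [h0, coeff_zero] at hcoeff
    exact hB hcoeff.symm
  intro hB
  obtain ⟨v, hv, hvB⟩ := Matrix.exists_vecMul_eq_zero_iff.2 hB
  apply hv
  funext h₀
  -- One block of `B`: rows `s` and columns `I` are equinumerous, and `x` is injective on `I`
  -- because `k` is constant there.
  let s := Finset.univ.filter fun h => κ h = κ h₀
  let I := Finset.univ.filter fun i => k i = κ h₀
  have hI : ∀ i ∈ I, k i = κ h₀ := fun i hi => by simpa [I] using hi
  refine coeff_eq_zero_of_vanishing_at_rootsOfUnity (n := n) hp s (I.image x) ?_ ?_ r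
    (fun i _ j _ => hr i j) v ?_ h₀ (by simp [s])
  · rw [Finset.card_image_of_injOn fun i hi j hj hij =>
      hxk i j hij ((hI i hi).trans (hI j hj).symm)]
    exact (hfib σ₀ _).le
  · simp only [Finset.mem_image]
    rintro _ ⟨i, -, rfl⟩
    exact hx i
  · simp only [Finset.mem_image]
    rintro _ ⟨i, hi, rfl⟩
    have := congrFun hvB i
    simp only [Matrix.vecMul, dotProduct, B, Matrix.of_apply, Pi.zero_apply, mul_ite, mul_zero,
      hI i hi] at this
    rw [← this, Finset.sum_filter]
    exact Finset.sum_congr rfl fun h _ => by simp only [eq_comm]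

/-- Weights on a finite type that grow fast. -/
theorem exists_fast_weight (H : Type*) [Finite H] : ∃ w : H → ℕ, Function.Injective w ∧
    ∀ a b g, w a < w g → w b < w g → w a + w b < w g := by
  obtain ⟨m, ⟨e⟩⟩ := Finite.exists_equiv_fin H
  -- Base 3, since two smaller powers of 2 can sum to the next one.
  refine ⟨fun h => 3 ^ (e h : ℕ), fun a b h => ?_, fun a b g ha hb => ?_⟩
  · exact e.injective (Fin.ext (Nat.pow_right_injective (le_refl 2 |>.trans (by norm_num)) h))
  · have h1 := (Nat.pow_lt_pow_iff_right (by norm_num : 1 < 3)).1 ha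
    have h2 := (Nat.pow_lt_pow_iff_right (by norm_num : 1 < 3)).1 hb
    have h3 : 3 ^ ((e a : ℕ) + 1) ≤ 3 ^ (e g : ℕ) := Nat.pow_le_pow_right (by norm_num) h1
    have h4 : 3 ^ ((e b : ℕ) + 1) ≤ 3 ^ (e g : ℕ) := Nat.pow_le_pow_right (by norm_num) h2
    have : 0 < 3 ^ (e g : ℕ) := by positivity
    simp only [pow_succ] at h3 h4 ⊢
    omega

/-! ### Frames are spanning sequences -/

/-- A finite spanning sequence in a finite-dimensional space is a frame. -/
theorem isFrame_of_span_eq_top {V : Type*} [NormedAddCommGroup V] [InnerProductSpace ℂ V]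
    [FiniteDimensional ℂ V] {I : Type*} [Finite I] (v : I → V)
    (hv : Submodule.span ℂ (Set.range v) = ⊤) : IsFrame v := by
  have := Fintype.ofFinite I
  let f : V →ₗ[ℂ] EuclideanSpace ℂ I :=
    { toFun := fun w => WithLp.toLp 2 fun k => inner ℂ (v k) w
      map_add' := fun a b => by ext k; simp
      map_smul' := fun a b => by ext k; simp }
  have hnorm : ∀ w : V, ∑ᶠ k, ‖inner ℂ w (v k)‖ ^ 2 = ‖f w‖ ^ 2 := by
    intro w
    rw [finsum_eq_sum_of_fintype, EuclideanSpace.norm_sq_eq]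
    exact Finset.sum_congr rfl fun k _ => by simp [f, norm_inner_symm w]
  have hker : LinearMap.ker f = ⊥ := by
    rw [LinearMap.ker_eq_bot']
    intro w hw
    have h1 : ∀ y ∈ Submodule.span ℂ (Set.range v), inner ℂ y w = 0 := by
      intro y hy
      induction hy using Submodule.span_induction with
      | mem y hy =>
        obtain ⟨k, rfl⟩ := hy
        simpa [f] using congrArg (fun z : EuclideanSpace ℂ I => z k) hw
      | zero => simp
      | add a b _ _ ha hb => rw [inner_add_left, ha, hb, add_zero]
      | smul c a _ ha => rw [inner_smul_left, ha, mul_zero]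
    exact inner_self_eq_zero.1 (h1 w (hv ▸ Submodule.mem_top))
  obtain ⟨K, hK, hf⟩ := f.exists_antilipschitzWith hker
  have hK' : (0 : ℝ) < K := hK
  let F := LinearMap.toContinuousLinearMap f
  -- The maximum secures `A ≤ B` even on the zero space.
  refine ⟨((K : ℝ) ^ 2)⁻¹, max ((K : ℝ) ^ 2)⁻¹ (‖F‖ ^ 2), by positivity, le_max_left _ _,
    fun w => ⟨?_, ?_⟩⟩
  · rw [hnorm, inv_mul_le_iff₀ (by positivity), ← mul_pow]
    have := hf.le_mul_dist w 0
    rw [map_zero, dist_zero_right, dist_zero_right] at this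
    gcongr
  · rw [hnorm]
    calc ‖f w‖ ^ 2 ≤ (‖F‖ * ‖w‖) ^ 2 := by gcongr; exact F.le_opNorm w
      _ = ‖F‖ ^ 2 * ‖w‖ ^ 2 := mul_pow _ _ _
      _ ≤ _ := by gcongr; exact le_max_right _ _

/-- A frame of a finite-dimensional space spans it. -/
theorem IsFrame.span_eq_top {V : Type*} [NormedAddCommGroup V] [InnerProductSpace ℂ V]
    [FiniteDimensional ℂ V] {I : Type*} [Finite I] {v : I → V} (hv : IsFrame v) :
    Submodule.span ℂ (Set.range v) = ⊤ := by
  obtain ⟨A, B, hA, -, h⟩ := hv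
  rw [← Submodule.orthogonal_eq_bot_iff, Submodule.eq_bot_iff]
  intro w hw
  have h1 := (h w).1
  have h2 : ∀ k, inner ℂ w (v k) = 0 := fun k =>
    Submodule.inner_left_of_mem_orthogonal (Submodule.subset_span (Set.mem_range_self k)) hw
  simp only [h2, norm_zero, ne_eq, OfNat.ofNat_ne_zero, not_false_eq_true, zero_pow,
    finsum_zero] at h1
  have h3 : ‖w‖ ^ 2 = 0 := le_antisymm (by nlinarith) (by positivity)
  simpa using h3

/-! ### Automorphisms of `ℤ_N` as multipliers -/

namespace AutZMod

variable {N : ℕ}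

/-- The multiplier in `ℤ_N` of an automorphism of `ℤ_N`. -/
def multiplier (h : AutZMod N) : ZMod N := Multiplicative.toAdd (h (Multiplicative.ofAdd 1))

variable [NeZero N]

theorem toAdd_apply (h : AutZMod N) (y : Multiplicative (ZMod N)) :
    Multiplicative.toAdd (h y) = Multiplicative.toAdd y * h.multiplier := by
  have hy : y = Multiplicative.ofAdd (1 : ZMod N) ^ (Multiplicative.toAdd y).val := by
    apply Multiplicative.toAdd.injective
    simp
  rw [hy, map_pow, toAdd_pow, toAdd_pow]
  simp [multiplier]

theorem multiplier_injective : Function.Injective (multiplier : AutZMod N → ZMod N) := by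
  intro h h' e
  ext y
  apply Multiplicative.toAdd.injective
  rw [toAdd_apply, toAdd_apply, e]

end AutZMod

/-! ### The induced representation is irreducible and full spark -/

section Induced

variable {N : ℕ} [NeZero N] {H : Subgroup (AutZMod N)}

open ZMod

/-- The operators of the representation of `ℤ_N ⋊ H` induced from the standard character. -/
noncomputable def inducedOp (g : CyclicSemidirect N H) :
    EuclideanSpace ℂ H →ₗ[ℂ] EuclideanSpace ℂ H where
  toFun f := WithLp.toLp 2 fun h =>
    stdAddChar (Multiplicative.toAdd ((h : AutZMod N) g.left)) * f (h * g.right)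
  map_add' f f' := by ext h; simp [mul_add]
  map_smul' c f := by ext h; simp; ring

theorem inducedOp_apply (g : CyclicSemidirect N H) (f : EuclideanSpace ℂ H) (h : H) :
    inducedOp g f h =
      stdAddChar (Multiplicative.toAdd ((h : AutZMod N) g.left)) * f (h * g.right) := rfl

theorem inducedOp_mul (g g' : CyclicSemidirect N H) (f : EuclideanSpace ℂ H) :
    inducedOp (g * g') f = inducedOp g (inducedOp g' f) := by
  ext h
  simp only [inducedOp_apply, SemidirectProduct.mul_left, SemidirectProduct.mul_right, map_mul,
    toAdd_mul, AddChar.map_add_eq_mul, mul_assoc, Subgroup.coe_mul, MulAut.mul_apply,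
    Subgroup.subtype_apply]

theorem inducedOp_one (f : EuclideanSpace ℂ H) :
    inducedOp (1 : CyclicSemidirect N H) f = f := by
  ext h
  simp [inducedOp_apply]

variable [Fintype H]

theorem norm_inducedOp (g : CyclicSemidirect N H) (f : EuclideanSpace ℂ H) :
    ‖inducedOp g f‖ = ‖f‖ := by
  rw [EuclideanSpace.norm_eq, EuclideanSpace.norm_eq,
    ← Equiv.sum_comp (Equiv.mulRight g.right) fun h => ‖f h‖ ^ 2]
  congr 1
  refine Finset.sum_congr rfl fun h _ => ?_
  rw [inducedOp_apply, norm_mul, AddChar.norm_apply, one_mul]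
  rfl

variable (N H) in
/-- The unitary representation of `ℤ_N ⋊ H` induced from the standard character of `ℤ_N`. -/
noncomputable def inducedRep : UnitaryRep (CyclicSemidirect N H) (EuclideanSpace ℂ H) where
  toFun g :=
    { toLinearEquiv := LinearEquiv.ofLinearMap (inducedOp g) (inducedOp g⁻¹)
        (by ext1 f; simp [← inducedOp_mul, inducedOp_one])
        (by ext1 f; simp [← inducedOp_mul, inducedOp_one])
      norm_map' := norm_inducedOp g }
  map_one' := LinearIsometryEquiv.ext inducedOp_one
  map_mul' g g' := LinearIsometryEquiv.ext (inducedOp_mul g g')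

theorem inducedRep_apply (g : CyclicSemidirect N H) (f : EuclideanSpace ℂ H) (h : H) :
    inducedRep N H g f h =
      stdAddChar (Multiplicative.toAdd g.left * (h : AutZMod N).multiplier) * f (h * g.right) := by
  rw [← AutZMod.toAdd_apply]; rfl

/-- Distinct `h` give distinct characters of `ℤ_N`, so averaging against one of them isolates a
single coordinate of a nonzero vector; `H` then permutes the coordinate vectors transitively. -/
theorem inducedRep_isIrreducible : (inducedRep N H).IsIrreducible := by
  classical
  have hbot : (⊥ : Subrepresentation (inducedRep N H).toRepresentation) ≠ ⊤ := by
    intro h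
    have : (⊥ : Submodule ℂ (EuclideanSpace ℂ H)) = ⊤ := congrArg (·.toSubmodule) h
    exact bot_ne_top this
  refine { exists_pair_ne := ⟨_, _, hbot⟩, eq_bot_or_eq_top := fun W => ?_ }
  have hmem : ∀ g, ∀ f ∈ W.toSubmodule, inducedRep N H g f ∈ W.toSubmodule :=
    fun g f hf => W.apply_mem_toSubmodule g hf
  by_cases hW : W.toSubmodule = ⊥
  · exact Or.inl (Subrepresentation.toSubmodule_injective hW)
  right
  obtain ⟨f, hf, hf0⟩ := Submodule.exists_mem_ne_zero_of_ne_bot hW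
  obtain ⟨h₀, hh₀⟩ : ∃ h, f h ≠ 0 := by
    by_contra! hcon
    exact hf0 (by ext h; simpa using hcon h)
  have hproj : ∑ a : ZMod N, (stdAddChar (-(a * (h₀ : AutZMod N).multiplier)) : ℂ) •
      inducedRep N H (SemidirectProduct.inl (Multiplicative.ofAdd a)) f =
      (N * f h₀) • EuclideanSpace.single h₀ (1 : ℂ) := by
    ext h
    have hterm : ∀ a : ZMod N, (stdAddChar (-(a * (h₀ : AutZMod N).multiplier)) : ℂ) *
        (stdAddChar (a * (h : AutZMod N).multiplier) * f h) =
        stdAddChar (a * ((h : AutZMod N).multiplier - (h₀ : AutZMod N).multiplier)) * f h := by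
      intro a
      rw [← mul_assoc, ← AddChar.map_add_eq_mul]
      congr 2
      ring
    simp only [WithLp.ofLp_sum, WithLp.ofLp_smul, Finset.sum_apply, Pi.smul_apply, smul_eq_mul,
      inducedRep_apply, SemidirectProduct.left_inl, SemidirectProduct.right_inl, toAdd_ofAdd,
      mul_one, hterm]
    rw [← Finset.sum_mul, AddChar.sum_mulShift _ (isPrimitive_stdAddChar N)]
    by_cases hh : h = h₀
    · subst hh; simp
    · rw [if_neg]
      · simp [hh]
      · rw [sub_eq_zero]
        exact fun e => hh (Subtype.ext (AutZMod.multiplier_injective e))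
  have hsingle₀ : EuclideanSpace.single h₀ (1 : ℂ) ∈ W.toSubmodule := by
    have hN : ((N : ℂ) * f h₀) ≠ 0 := mul_ne_zero (NeZero.ne _) hh₀
    rw [← Submodule.smul_mem_iff _ hN, ← hproj]
    exact Submodule.sum_mem _ fun a _ => Submodule.smul_mem _ _ (hmem _ _ hf)
  have hsingle : ∀ h : H, EuclideanSpace.single h (1 : ℂ) ∈ W.toSubmodule := by
    intro h
    have heq : inducedRep N H (SemidirectProduct.inr (h⁻¹ * h₀)) (EuclideanSpace.single h₀ 1) =
        EuclideanSpace.single h (1 : ℂ) := by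
      ext h'
      rw [inducedRep_apply]
      simp [← mul_assoc, mul_inv_eq_one]
    exact heq ▸ hmem _ _ hsingle₀
  apply Subrepresentation.toSubmodule_injective
  refine eq_top_iff.2 fun y _ => ?_
  have hy : y = ∑ h, y h • EuclideanSpace.single h (1 : ℂ) := by
    ext h; simp [Pi.single_apply]
  rw [hy]
  exact Submodule.sum_mem _ fun h _ => Submodule.smul_mem _ _ (hsingle h)

/-- Each subset of `|H|` group elements excludes only the roots of one nonzero polynomial in `t`,
and there are finitely many subsets. -/
theorem inducedRep_isFullSpark {p n : ℕ} (hp : p.Prime) (hN : N = p ^ n)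
    (hres : ∀ h ∈ H, ∀ h' ∈ H, h ≠ h' → ¬ AutZMod.residue h ≡ AutZMod.residue h' [MOD p]) :
    (inducedRep N H).IsFullSpark := by
  classical
  have := Fintype.ofFinite (CyclicSemidirect N H)
  obtain ⟨w, hinj, hw⟩ := exists_fast_weight H
  let v : ℂ → EuclideanSpace ℂ H := fun t => WithLp.toLp 2 fun h => t ^ w h
  have hpoly : ∀ s : Finset (CyclicSemidirect N H), ∃ P : Polynomial ℂ, P ≠ 0 ∧
      (s.card = Fintype.card H → ∀ t, P.eval t ≠ 0 →
        LinearIndependent ℂ fun g : s => inducedRep N H g (v t)) := by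
    intro s
    by_cases hs : s.card = Fintype.card H
    swap
    · exact ⟨1, one_ne_zero, fun h => absurd h hs⟩
    let e : H ≃ s := Fintype.equivOfCardEq (by rw [Fintype.card_coe, hs])
    refine ⟨_, det_orbit_ne_zero hinj hw (n := n) hp (fun h : H => AutZMod.residue (h : AutZMod N))
      ?_ (fun j => stdAddChar (Multiplicative.toAdd (e j : CyclicSemidirect N H).left)) ?_
      (fun j => (e j : CyclicSemidirect N H).right) ?_, fun _ t ht => ?_⟩
    · intro h h' hh
      by_contra hne
      exact hres h h.2 h' h'.2 (fun e => hne (Subtype.ext e)) hh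
    · intro j
      rw [← AddChar.map_nsmul_eq_pow, ← hN]
      simp
    · intro i j hij hk
      apply e.injective
      apply Subtype.ext
      exact SemidirectProduct.ext (Multiplicative.toAdd.injective (injective_stdAddChar hij)) hk
    · rw [← Polynomial.coe_evalRingHom, RingHom.map_det, ← isUnit_iff_ne_zero,
        ← Matrix.isUnit_iff_isUnit_det, ← Matrix.linearIndependent_cols_iff_isUnit] at ht
      rw [← linearIndependent_equiv e]
      refine LinearIndependent.of_comp (WithLp.linearEquiv 2 ℂ (H → ℂ)).toLinearMap ?_
      have hcols : ∀ f : H → H → ℂ, f = (fun j h => inducedRep N H (e j) (v t) h) →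
          LinearIndependent ℂ f →
          LinearIndependent ℂ fun j h => inducedRep N H (e j) (v t) h := by
        rintro _ rfl h
        exact h
      refine hcols _ ?_ ht
      funext j h
      have : ∀ a : ZMod N, (stdAddChar (a * (h : AutZMod N).multiplier) : ℂ) =
          stdAddChar a ^ AutZMod.residue (h : AutZMod N) := by
        intro a
        rw [← AddChar.map_nsmul_eq_pow, nsmul_eq_mul, mul_comm, AutZMod.residue,
          ZMod.natCast_zmod_val]
        rfl
      change _ = inducedRep N H (e j) (v t) h
      rw [inducedRep_apply, this]
      simp [v, Matrix.col, Matrix.transpose]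
  choose P hP0 hP using hpoly
  have hprod : ∏ s, P s ≠ 0 := Finset.prod_ne_zero_iff.2 fun s _ => hP0 s
  obtain ⟨t, ht⟩ : ∃ t, (∏ s, P s).eval t ≠ 0 := by
    by_contra! hcon
    exact hprod (Polynomial.funext (by simpa using hcon))
  rw [Polynomial.eval_prod, Finset.prod_ne_zero_iff] at ht
  have hli : ∀ s : Finset (CyclicSemidirect N H),
      s.card = Module.finrank ℂ (EuclideanSpace ℂ H) →
      LinearIndependent ℂ fun g : s => inducedRep N H g (v t) := fun s hs =>
    hP s (hs.trans finrank_euclideanSpace) t (ht s (Finset.mem_univ s))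
  refine ⟨v t, isFrame_of_span_eq_top _ ?_, hli⟩
  -- The copy of `H` has exactly `|H|` elements, so its part of the orbit is already a basis.
  let s : Finset (CyclicSemidirect N H) :=
    Finset.univ.map ⟨SemidirectProduct.inr, SemidirectProduct.inr_injective⟩
  have hs : s.card = Module.finrank ℂ (EuclideanSpace ℂ H) := by
    rw [Finset.card_map, finrank_euclideanSpace, Finset.card_univ]
  have htop := (hli s hs).span_eq_top_of_card_eq_finrank' (by rw [Fintype.card_coe, hs])
  refine top_le_iff.1 (htop ▸ Submodule.span_mono ?_)
  rintro _ ⟨g, rfl⟩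
  exact ⟨g, rfl⟩

end Induced

/-! ### Spark deficiency -/

section Deficient

variable {N : ℕ} [NeZero N] {H : Subgroup (AutZMod N)} {V : Type w} [NormedAddCommGroup V]
  [InnerProductSpace ℂ V]

/-- Finitely many terms of a full spark frame, no more than the dimension, are independent. -/
theorem IsFullSparkFrame.linearIndependent_of_card_le [FiniteDimensional ℂ V] {I : Type*}
    [Finite I] {v : I → V} (hv : IsFullSparkFrame v) {ι : Type*} [Fintype ι] (f : ι → I)
    (hf : Function.Injective f) (hcard : Fintype.card ι ≤ Module.finrank ℂ V) :
    LinearIndependent ℂ fun i => v (f i) := by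
  classical
  have := Fintype.ofFinite I
  have hle : Module.finrank ℂ V ≤ (Finset.univ : Finset I).card := by
    rw [← finrank_top, ← hv.1.span_eq_top]
    exact finrank_range_le_card v
  obtain ⟨s, hs, -, hscard⟩ := Finset.exists_subsuperset_card_eq
    (Finset.subset_univ (Finset.univ.map ⟨f, hf⟩)) (by simpa using hcard) hle
  exact (hv.2 s hscard).comp (fun i => ⟨f i, hs (by simp)⟩)
    fun i j hij => hf (congrArg Subtype.val hij)

/-- An automorphism of a cyclic group sends each element to a power of itself. This makes the fixed
space of a translation invariant under the whole group. -/
theorem conj_inl_eq_pow (a : Multiplicative (ZMod N)) (g : CyclicSemidirect N H) :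
    ∃ m : ℕ, SemidirectProduct.inl a * g = g * SemidirectProduct.inl (a ^ m) := by
  have h1 : (g.right : AutZMod N)
      (a ^ ((g.right : AutZMod N)⁻¹ : AutZMod N).multiplier.val) = a := by
    have : a ^ ((g.right : AutZMod N)⁻¹ : AutZMod N).multiplier.val =
        ((g.right : AutZMod N)⁻¹ : AutZMod N) a := by
      apply Multiplicative.toAdd.injective
      rw [AutZMod.toAdd_apply, toAdd_pow, nsmul_eq_mul, ZMod.natCast_zmod_val, mul_comm]
    rw [this, MulAut.apply_inv_self]
  refine ⟨((g.right : AutZMod N)⁻¹ : AutZMod N).multiplier.val,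
    SemidirectProduct.ext ?_ (by simp [-map_pow])⟩
  rw [SemidirectProduct.mul_left, SemidirectProduct.mul_left, SemidirectProduct.left_inl,
    SemidirectProduct.right_inl, SemidirectProduct.left_inl, map_one, MulAut.one_apply,
    Subgroup.subtype_apply, h1, mul_comm]

/-- The vectors fixed by an element of `ℤ_N` are all or nothing. -/
theorem UnitaryRep.inl_fixes_all {π : UnitaryRep (CyclicSemidirect N H) V}
    (hπ : π.IsIrreducible) (a : Multiplicative (ZMod N)) {x : V} (hx : x ≠ 0)
    (hax : π (SemidirectProduct.inl a) x = x) (y : V) : π (SemidirectProduct.inl a) y = y := by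
  have hpow : ∀ (z : V), π (SemidirectProduct.inl a) z = z → ∀ m : ℕ,
      π (SemidirectProduct.inl (a ^ m)) z = z := by
    intro z hz m
    induction m with
    | zero => simp
    | succ m ih =>
      rw [pow_succ, map_mul, map_mul]
      exact (congrArg _ hz).trans ih
  let W : Subrepresentation π.toRepresentation :=
    { toSubmodule := LinearMap.eqLocus (π.toRepresentation (SemidirectProduct.inl a)) LinearMap.id
      apply_mem_toSubmodule := by
        intro g z hz
        change π (SemidirectProduct.inl a) (π g z) = π g z
        obtain ⟨m, hm⟩ := conj_inl_eq_pow a g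
        have : π (SemidirectProduct.inl a) (π g z) = π (SemidirectProduct.inl a * g) z := by
          rw [map_mul]; rfl
        rw [this, hm, map_mul]
        exact congrArg (π g) (hpow z hz m) }
  have : IsSimpleOrder (Subrepresentation π.toRepresentation) := hπ
  have hxW : x ∈ W.toSubmodule := hax
  have hyW : y ∈ W.toSubmodule := by
    rcases eq_bot_or_eq_top W with h | h
    · rw [h] at hxW
      exact absurd ((Submodule.mem_bot ℂ).1 hxW) hx
    · rw [h]; exact Submodule.mem_top
  exact hyW

theorem irreduciblySparkDeficient_of_minFac_le (hN : 1 < N) (hH : N.minFac ≤ Nat.card H) :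
    IrreduciblySparkDeficient.{0, w} (CyclicSemidirect N H) := by
  intro V _ _ _ π hπ hdim v hv
  have hsimple : IsSimpleOrder (Subrepresentation π.toRepresentation) := hπ
  have hnt : Nontrivial V := by
    by_contra hsub
    rw [not_nontrivial_iff_subsingleton] at hsub
    refine bot_ne_top (α := Subrepresentation π.toRepresentation) ?_
    exact Subrepresentation.toSubmodule_injective (Subsingleton.elim _ _)
  have hdim2 : 2 ≤ Module.finrank ℂ V := by
    have := Module.finrank_pos (R := ℂ) (M := V)
    omega
  have hmul : ∀ g g' x, π (g * g') x = π g (π g' x) := fun g g' x => by rw [map_mul]; rfl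
  -- A translation `a ≠ 1` with a nonzero fixed vector acts trivially, so the orbit terms at `1` and
  -- `a` coincide, which is impossible in dimension at least 2.
  have hfix : ∀ (a : Multiplicative (ZMod N)) (x : V), x ≠ 0 →
      π (SemidirectProduct.inl a) x = x → a = 1 := by
    intro a x hx hax
    by_contra ha
    have hli := hv.linearIndependent_of_card_le
      (![1, SemidirectProduct.inl a] : Fin 2 → CyclicSemidirect N H) ?_ (by simpa using hdim2)
    · have heq : π (SemidirectProduct.inl a) v = π 1 v := by
        rw [UnitaryRep.inl_fixes_all hπ a hx hax, map_one]; rfl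
      exact absurd (hli.injective (a₁ := 0) (a₂ := 1) (by simpa using heq.symm)) (by simp)
    · intro i j hij
      have h1 : SemidirectProduct.inl a ≠ (1 : CyclicSemidirect N H) := fun h =>
        ha (SemidirectProduct.inl_injective (h.trans (map_one _).symm))
      fin_cases i <;> fin_cases j <;> simp_all
  let a₀ : Multiplicative (ZMod N) := Multiplicative.ofAdd 1
  let T : Module.End ℂ V := π.toRepresentation (SemidirectProduct.inl a₀)
  have hT : ∀ x, T x = π (SemidirectProduct.inl a₀) x := fun _ => rfl
  obtain ⟨μ, hμ⟩ := Module.End.exists_eigenvalue T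
  obtain ⟨x, hx⟩ := hμ.exists_hasEigenvector
  have hx0 := hx.2
  have hTx : π (SemidirectProduct.inl a₀) x = μ • x := hx.apply_eq_smul
  have hμ0 : μ ≠ 0 := by
    rintro rfl
    rw [zero_smul] at hTx
    exact hx0 ((π _).injective (hTx.trans (map_zero _).symm))
  have hpow : ∀ m : ℤ, π (SemidirectProduct.inl (a₀ ^ m)) x = μ ^ m • x := by
    have hnat : ∀ m : ℕ, π (SemidirectProduct.inl (a₀ ^ m)) x = μ ^ m • x := by
      intro m
      induction m with
      | zero => simp
      | succ m ih => rw [pow_succ, map_mul, hmul, hTx, map_smul, ih, smul_smul, pow_succ']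
    intro m
    cases m with
    | ofNat m => simpa using hnat m
    | negSucc m =>
      apply (π (SemidirectProduct.inl (a₀ ^ (m + 1)))).injective
      rw [← hmul, ← map_mul, zpow_negSucc, mul_inv_cancel, map_one, map_one, map_smul, hnat,
        smul_smul, zpow_negSucc, inv_mul_cancel₀ (pow_ne_zero _ hμ0), one_smul]
      rfl
  have hcard : Nat.card H ≤ Module.finrank ℂ V := by
    have := Fintype.ofFinite H
    have hgen : ∀ h : H, ∃ m : ℤ, (h : AutZMod N)⁻¹ a₀ = a₀ ^ m := by
      intro h
      obtain ⟨m, hm⟩ := MonoidHom.map_cyclic ((h : AutZMod N)⁻¹ : AutZMod N).toMonoidHom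
      exact ⟨m, hm a₀⟩
    choose m hm using hgen
    -- Equal eigenvalues would make `a₀ ^ (m h - m h')` fix `x`, hence be trivial.
    have hinj : Function.Injective fun h : H => μ ^ m h := by
      intro h h' e
      have e : μ ^ m h = μ ^ m h' := e
      have h1 : a₀ ^ (m h - m h') = 1 := by
        apply hfix _ x hx0
        rw [hpow, zpow_sub₀ hμ0, e, div_self (zpow_ne_zero _ hμ0), one_smul]
      rw [zpow_sub, mul_inv_eq_one, ← hm, ← hm] at h1
      exact inv_injective (Subtype.ext (AutZMod.multiplier_injective
        (congrArg Multiplicative.toAdd h1)))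
    have hli := Module.End.eigenvectors_linearIndependent' T (fun h : H => μ ^ m h) hinj
      (fun h => π (SemidirectProduct.inr h) x) fun h => by
        rw [Module.End.hasEigenvector_iff, Module.End.mem_eigenspace_iff]
        refine ⟨?_, fun h0 => hx0 ((π _).injective (h0.trans (map_zero _).symm))⟩
        have hcomm : (SemidirectProduct.inl a₀ * SemidirectProduct.inr h : CyclicSemidirect N H) =
            SemidirectProduct.inr h * SemidirectProduct.inl (a₀ ^ m h) := by
          rw [← hm]
          ext <;> simp
        rw [hT, ← hmul, hcomm, hmul, hpow, map_smul]
    rw [Nat.card_eq_fintype_card]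
    exact hli.fintype_card_le_finrank
  have hp : N.minFac.Prime := Nat.minFac_prime hN.ne'
  obtain ⟨l, hl⟩ := N.minFac_dvd
  have hord : orderOf a₀ = N := by
    rw [orderOf_ofAdd_eq_addOrderOf, ZMod.addOrderOf_one]
  have hl0 : l ≠ 0 := by rintro rfl; exact NeZero.ne N hl
  have hb : orderOf (a₀ ^ l) = N.minFac := by
    rw [orderOf_pow_of_dvd hl0 (by rw [hord]; exact Dvd.intro_left _ hl.symm), hord]
    exact Nat.div_eq_of_eq_mul_left (Nat.pos_of_ne_zero hl0) hl
  set b := a₀ ^ l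
  have hbN : b ^ N.minFac = 1 := hb ▸ pow_orderOf_eq_one b
  have hli := hv.linearIndependent_of_card_le
    (fun i : Fin N.minFac => (SemidirectProduct.inl (b ^ (i : ℕ)) : CyclicSemidirect N H)) ?_
    (by simpa using hH.trans hcard)
  -- Multiplication by `b` permutes the summands cyclically, so a nonzero sum would contradict
  -- `hfix`.
  · have hsum : ∑ i : Fin N.minFac, π (SemidirectProduct.inl (b ^ (i : ℕ))) v = 0 := by
      by_contra hs
      have hb1 := hfix b _ hs ?_
      · rw [hb1, orderOf_one] at hb
        exact hp.one_lt.ne hb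
      · rw [Fin.sum_univ_eq_sum_range (fun i => π (SemidirectProduct.inl (b ^ i)) v), map_sum]
        have hstep : ∀ i, π (SemidirectProduct.inl b) (π (SemidirectProduct.inl (b ^ i)) v) =
            π (SemidirectProduct.inl (b ^ (i + 1))) v := by
          intro i
          rw [← hmul, ← map_mul, ← pow_succ']
        simp only [hstep]
        have h1 := Finset.sum_range_succ (fun i => π (SemidirectProduct.inl (b ^ i)) v) N.minFac
        rw [Finset.sum_range_succ', hbN, pow_zero] at h1
        exact add_right_cancel h1
    have := Fintype.linearIndependent_iff.1 hli (fun _ => 1) (by simpa using hsum) ⟨0, hp.pos⟩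
    exact one_ne_zero this
  · intro i j hij
    have := SemidirectProduct.inl_injective hij
    exact Fin.ext (pow_injOn_Iio_orderOf (by simp [hb]) (by simp [hb]) this)

end Deficient

theorem mainTheorem2 (N : ℕ) [NeZero N] (H : Subgroup (AutZMod N)) :
    (1 < N → ¬ N.Prime → N.minFac ≤ Nat.card H →
      IrreduciblySparkDeficient.{0, w} (CyclicSemidirect N H)) ∧
    (∀ p n : ℕ, p.Prime → N = p ^ n → Nat.card H < p →
      (∀ h ∈ H, ∀ h' ∈ H, h ≠ h' → ¬ AutZMod.residue h ≡ AutZMod.residue h' [MOD p]) →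
      ∃ (V : Type) (_ : NormedAddCommGroup V) (_ : InnerProductSpace ℂ V)
        (_ : FiniteDimensional ℂ V) (π : UnitaryRep (CyclicSemidirect N H) V),
        π.IsIrreducible ∧ Module.finrank ℂ V = Nat.card H ∧ π.IsFullSpark) := by
  refine ⟨fun hN _ hH => irreduciblySparkDeficient_of_minFac_le hN hH,
    fun p n hp hN _ hres => ?_⟩
  have := Fintype.ofFinite H
  exact ⟨EuclideanSpace ℂ H, inferInstance, inferInstance, inferInstance, inducedRep N H,
    inducedRep_isIrreducible, by rw [finrank_euclideanSpace, Nat.card_eq_fintype_card],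
    inducedRep_isFullSpark hp hN hres⟩
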